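/- Let $\mathcal X$ be a Polish space with its Borel $\sigma$-algebra and let $\mathcal Y$ be a measurable space (for instance a topological space with its Borel $\sigma$-algebra). Let $\gamma\mapsto\mu_\gamma$ be a measurable family of Borel probability measures on $\mathcal X$ indexed by $\gamma\in\mathcal Y$, i.e. $\gamma\mapsto\mu_\gamma(A)$ is measurable for every Borel set $A\subseteq\mathcal X$. Let $c:\mathcal X\times\mathcal X\to[0,\infty)$ be lower semicontinuous. For Borel probability measures $\mu,\nu$ on $\mathcal X$ let $\mathcal C(\mu,\nu)$ be the set of Borel probability measures on $\mathcal X\times\mathcal X$ with first marginal $\mu$ and second marginal $\nu$, and let \[ \mathcal W_c(\mu,\nu)=\inf_{\xi\in\mathcal C(\mu,\nu)}\int_{\mathcal X\times\mathcal X}c(u,v)\,\xi(du,dv)\in[0,\infty]. \] Then the function $(\gamma,\gamma')\mapsto\mathcal W_c(\mu_\gamma,\mu_{\gamma'})$ from $\mathcal Y\times\mathcal Y$ (with the product $\sigma$-algebra) to $[0,\infty]$ is measurable. Moreover, there is a measurable selection of optimal couplings: a family $(\xi_{\gamma,\gamma'})_{\gamma,\gamma'\in\mathcal Y}$ with $\xi_{\gamma,\gamma'}\in\mathcal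 C(\mu_\gamma,\mu_{\gamma'})$ and \[ \int_{\mathcal X\times\mathcal X}c(u,v)\,\xi_{\gamma,\gamma'}(du,dv)=\mathcal W_c(\mu_\gamma,\mu_{\gamma'}) \] for all $\gamma,\gamma'\in\mathcal Y$, such that $(\gamma,\gamma')\mapsto\xi_{\gamma,\gamma'}(B)$ is measurable on $\mathcal Y\times\mathcal Y$ for every Borel set $B\subseteq\mathcal X\times\mathcal X$. -/

import Mathlib

open MeasureTheory
open scoped NNReal ENNReal

/-- The set `𝒞(μ, ν)` of couplings of two probability measures on `X`: the probability measures on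
`X × X` with first marginal `μ` and second marginal `ν`. -/
def couplings {X : Type*} [MeasurableSpace X] (μ ν : ProbabilityMeasure X) :
    Set (ProbabilityMeasure (X × X)) :=
  {ξ | (ξ : Measure (X × X)).fst = μ ∧ (ξ : Measure (X × X)).snd = ν}

/-- The integral of a nonnegative cost against a transport plan, with value in `[0, ∞]`. -/
noncomputable def planCost {X : Type*} [MeasurableSpace X] (c : X × X → ℝ≥0)
    (ξ : ProbabilityMeasure (X × X)) : ℝ≥0∞ :=
  ∫⁻ z, (c z : ℝ≥0∞) ∂(ξ : Measure (X × X))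

/-- The optimal transport cost `𝒲_c(μ, ν)`, the infimum over all couplings of the integral of the
cost, with value in `[0, ∞]`. -/
noncomputable def transportCost {X : Type*} [MeasurableSpace X] (c : X × X → ℝ≥0)
    (μ ν : ProbabilityMeasure X) : ℝ≥0∞ :=
  ⨅ ξ ∈ couplings μ ν, planCost c ξ

/-! Embed `X` in the Hilbert cube `K`. Probability measures on `K × K` form a compact space, and
couplings of pushed-forward marginals live on the image of `X × X`, so they pull back to `X × X`.
The cost becomes a lower semicontinuous functional `J`. The coupling sets are closed and depend
measurably on the parameter. On such a family the minimum of `J` is attained and measurable, and the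
minimizers form such a family again. Minimizing in turn the integrals of a dense sequence of test
functions then singles out one optimal plan, which is measurable because these integrals are. -/

/-- A family of nonempty closed sets which hits every closed set on a measurable set of parameters. -/
structure IsMeasurableClosedFamily {Ω S : Type*} [MeasurableSpace Ω] [TopologicalSpace S]
    (F : Ω → Set S) : Prop where
  isClosed : ∀ p, IsClosed (F p)
  nonempty : ∀ p, (F p).Nonempty
  measurableSet : ∀ C : Set S, IsClosed C → MeasurableSet {p | (F p ∩ C).Nonempty}

/-- The family of sets of minimizers of `J` on the members of a family of sets. -/
def argminFamily {Ω S : Type*} (F : Ω → Set S) (J : S → ℝ≥0∞) (p : Ω) : Set S :=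
  {x | x ∈ F p ∧ J x ≤ ⨅ y ∈ F p, J y}

theorem eq_iInf_of_mem_argminFamily {Ω S : Type*} {F : Ω → Set S} {J : S → ℝ≥0∞} {p : Ω} {x : S} (hx : x ∈ argminFamily F J p) :
    J x = ⨅ y ∈ F p, J y :=
  le_antisymm hx.2 (iInf₂_le x hx.1)

/-! ### Minimization and selection over measurable families of closed sets. -/

namespace IsMeasurableClosedFamily

variable {Ω S : Type*} [MeasurableSpace Ω] [TopologicalSpace S] [CompactSpace S]
  {F : Ω → Set S} {J : S → ℝ≥0∞}

theorem exists_eq_iInf_of_isClosed (hJ : LowerSemicontinuous J) {A : Set S} (hA : IsClosed A)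
    (hne : A.Nonempty) : ∃ x ∈ A, J x = ⨅ y ∈ A, J y := by
  obtain ⟨x, hx, hmin⟩ := LowerSemicontinuousOn.exists_isMinOn hne hA.isCompact
    (hJ.lowerSemicontinuousOn A)
  exact ⟨x, hx, le_antisymm (le_iInf₂ fun y hy => hmin hy) (iInf₂_le x hx)⟩

/-- By compactness a nonempty `F p ∩ C` attains its infimum, so a finite bound `a` holds iff `F p`
hits the closed set `C ∩ {J ≤ a}`. -/
theorem measurable_iInf_inter (hF : IsMeasurableClosedFamily F) (hJ : LowerSemicontinuous J)
    {C : Set S} (hC : IsClosed C) : Measurable fun p => ⨅ x ∈ F p ∩ C, J x := by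
  refine measurable_of_Iic fun a => ?_
  rcases eq_or_ne a ⊤ with rfl | ha
  · simp
  convert hF.measurableSet (C ∩ J ⁻¹' Set.Iic a) (hC.inter (hJ.isClosed_preimage a)) using 1
  ext p
  simp only [Set.mem_preimage, Set.mem_Iic, Set.mem_ofPred_eq]
  constructor
  · intro h
    have hne : (F p ∩ C).Nonempty := by
      by_contra hne
      rw [Set.not_nonempty_iff_eq_empty] at hne
      simp [hne] at h
      exact ha h
    obtain ⟨x, hx, hxe⟩ := exists_eq_iInf_of_isClosed hJ ((hF.isClosed p).inter hC) hne
    exact ⟨x, hx.1, hx.2, by simpa [hxe] using h⟩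
  · rintro ⟨x, hx, hxC, hxa⟩
    exact (iInf₂_le x ⟨hx, hxC⟩).trans hxa

theorem measurable_iInf (hF : IsMeasurableClosedFamily F) (hJ : LowerSemicontinuous J) :
    Measurable fun p => ⨅ x ∈ F p, J x := by
  simpa using hF.measurable_iInf_inter hJ isClosed_univ

theorem argminFamily (hF : IsMeasurableClosedFamily F) (hJ : LowerSemicontinuous J) :
    IsMeasurableClosedFamily (argminFamily F J) where
  isClosed p := (hF.isClosed p).inter (hJ.isClosed_preimage _)
  nonempty p := by
    obtain ⟨x, hx, h⟩ := exists_eq_iInf_of_isClosed hJ (hF.isClosed p) (hF.nonempty p)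
    exact ⟨x, hx, h.le⟩
  measurableSet C hC := by
    -- Nonemptiness is needed separately: an empty `F p ∩ C` has infimum `⊤`, and the minimum over
    -- `F p` may also be `⊤`.
    convert (hF.measurableSet C hC).inter
      (measurableSet_le (hF.measurable_iInf_inter hJ hC) (hF.measurable_iInf hJ)) using 1
    ext p
    constructor
    · rintro ⟨x, ⟨hx, hxJ⟩, hxC⟩
      exact ⟨⟨x, hx, hxC⟩,
        (iInf₂_le (f := fun y (_ : y ∈ F p ∩ C) => J y) x ⟨hx, hxC⟩).trans hxJ⟩
    · rintro ⟨hne, hle⟩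
      obtain ⟨x, hx, h⟩ := exists_eq_iInf_of_isClosed hJ ((hF.isClosed p).inter hC) hne
      exact ⟨x, ⟨hx.1, h.trans_le hle⟩, hx.2⟩

/-- Successive minimization of a sequence of functionals gives a selection along which each of them
is measurable. -/
theorem exists_selection (hF : IsMeasurableClosedFamily F) (g : ℕ → S → ℝ≥0∞)
    (hg : ∀ n, LowerSemicontinuous (g n)) :
    ∃ s : Ω → S, (∀ p, s p ∈ F p) ∧ ∀ n, Measurable fun p => g n (s p) := by
  let G : ℕ → Ω → Set S := fun n => Nat.rec F (fun k A => _root_.argminFamily A (g k)) n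
  have hG : ∀ n, IsMeasurableClosedFamily (G n) := by
    intro n
    induction n with
    | zero => exact hF
    | succ k ih => exact ih.argminFamily (hg k)
  have hne : ∀ p, (⋂ n, G n p).Nonempty := fun p =>
    IsCompact.nonempty_iInter_of_sequence_nonempty_isCompact_isClosed (fun n => G n p)
      (fun _ _ hx => And.left hx) (fun n => (hG n).nonempty p) ((hG 0).isClosed p).isCompact
      (fun n => (hG n).isClosed p)
  choose s hs using hne
  simp only [Set.mem_iInter] at hs
  refine ⟨s, fun p => hs p 0, fun n => ?_⟩
  -- As `s p` lies in `G (n + 1) p`, its value under `g n` is the minimum over `G n p`.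
  convert (hG n).measurable_iInf (hg n) using 2 with p
  exact eq_iInf_of_mem_argminFamily (hs p (n + 1))

/-- The fibres of a countable family of continuous functions over a measurable family of values. -/
theorem of_continuous_eq {ι Z : Type*} [Countable ι] [TopologicalSpace Z] [T2Space Z]
    [SecondCountableTopology Z] [MeasurableSpace Z] [BorelSpace Z] (H : ι → S → Z)
    (hH : ∀ i, Continuous (H i)) (t : ι → Ω → Z) (ht : ∀ i, Measurable (t i))
    (hne : ∀ p, ∃ x, ∀ i, H i x = t i p) :
    IsMeasurableClosedFamily fun p => {x | ∀ i, H i x = t i p} where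
  isClosed p := by
    simp only [Set.ofPred_forall]
    exact isClosed_iInter fun i => isClosed_eq (hH i) continuous_const
  nonempty := hne
  measurableSet C hC := by
    -- The image is compact; closed sets are measurable for the countable product σ-algebra because
    -- `Z` is second countable.
    have hm : MeasurableSet ((fun x i => H i x) '' C) :=
      (hC.isCompact.image (continuous_pi hH)).isClosed.measurableSet
    convert measurable_pi_lambda (fun p i => t i p) ht hm using 1
    ext p
    simp only [Set.mem_ofPred_eq, Set.mem_preimage, Set.mem_image, funext_iff]
    exact ⟨fun ⟨x, hx, hxC⟩ => ⟨x, hxC, hx⟩, fun ⟨x, hxC, hx⟩ => ⟨x, hx, hxC⟩⟩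

end IsMeasurableClosedFamily

/-! ### Measures on a compact space through countably many test functions. -/

section TestFunctions

theorem continuous_lintegral_testFunction {E : Type*} [TopologicalSpace E]
    [MeasurableSpace E] [BorelSpace E] (μ : Measure E) [IsFiniteMeasure μ] :
    Continuous fun f : BoundedContinuousFunction E ℝ≥0 => ∫⁻ x, f x ∂μ := by
  have h := (FiniteMeasure.testAgainstNN_lipschitz ⟨μ, inferInstance⟩).continuous
  convert ENNReal.continuous_coe.comp h using 2 with f
  exact (FiniteMeasure.testAgainstNN_coe_eq (μ := ⟨μ, inferInstance⟩) (f := f)).symm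

theorem exists_denseRange_testFunction (E : Type*) [TopologicalSpace E] [CompactSpace E]
    [T2Space E] [SecondCountableTopology E] :
    ∃ f : ℕ → BoundedContinuousFunction E ℝ≥0, DenseRange f := by
  let e := ContinuousMap.isometryEquivBoundedOfCompact E ℝ≥0
  exact ⟨_, e.surjective.denseRange.comp
    (TopologicalSpace.denseRange_denseSeq C(E, ℝ≥0)) e.continuous⟩

variable {E : Type*} [TopologicalSpace E] [CompactSpace E] [T2Space E] [SecondCountableTopology E]
  [MeasurableSpace E] [BorelSpace E]

variable {f : ℕ → BoundedContinuousFunction E ℝ≥0}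

theorem measure_eq_of_forall_lintegral_dense_eq (hf : DenseRange f) {μ ν : Measure E}
    [IsFiniteMeasure μ] [IsFiniteMeasure ν] (h : ∀ n, ∫⁻ x, f n x ∂μ = ∫⁻ x, f n x ∂ν) :
    μ = ν :=
  ext_of_forall_lintegral_eq_of_IsFiniteMeasure fun g =>
    hf.induction_on g (isClosed_eq (continuous_lintegral_testFunction μ)
      (continuous_lintegral_testFunction ν)) h

theorem measurable_of_forall_measurable_lintegral_dense {Ω : Type*} [MeasurableSpace Ω]
    (hf : DenseRange f) (ξ : Ω → Measure E) [∀ p, IsProbabilityMeasure (ξ p)]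
    (h : ∀ n, Measurable fun p => ∫⁻ x, f n x ∂ξ p) : Measurable ξ := by
  have hall : ∀ g : BoundedContinuousFunction E ℝ≥0, Measurable fun p => ∫⁻ x, g x ∂ξ p := by
    intro g
    obtain ⟨u, hu, hlim⟩ := mem_closure_iff_seq_limit.1 (hf g)
    refine measurable_of_tendsto_metrizable (f := fun n p => ∫⁻ x, u n x ∂ξ p) (fun n => ?_)
      (tendsto_pi_nhds.2 fun p => ((continuous_lintegral_testFunction (ξ p)).tendsto g).comp hlim)
    obtain ⟨m, hm⟩ := hu n
    simpa [← hm] using h m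
  refine Measurable.measure_of_isPiSystem_of_isProbabilityMeasure
    (borel_eq_generateFrom_isClosed (α := E) ▸ BorelSpace.measurable_eq) isPiSystem_isClosed
    fun s hs => ?_
  exact measurable_of_tendsto_metrizable (fun n => hall (hs.apprSeq n))
    (tendsto_pi_nhds.2 fun p => HasOuterApproxClosed.tendsto_lintegral_apprSeq hs (ξ p))

end TestFunctions

/-- A nonnegative lower semicontinuous function on a subspace of a metrizable space is the
increasing limit of continuous functions on the whole space (inf-convolutions with multiples of a
distance). -/
theorem exists_monotone_continuous_iSup_comp_eq {X E : Type*} [TopologicalSpace X]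
    [TopologicalSpace E] [TopologicalSpace.MetrizableSpace E] {j : X → E}
    (hj : Topology.IsEmbedding j) {c : X → ℝ≥0} (hc : LowerSemicontinuous c) :
    ∃ g : ℕ → E → ℝ≥0, (∀ n, Continuous (g n)) ∧ Monotone g ∧
      ∀ x, ⨆ n, (g n (j x) : ℝ≥0∞) = c x := by
  rcases isEmpty_or_nonempty X with hX | hX
  · exact ⟨fun _ _ => 0, fun _ => continuous_const, monotone_const, fun x => hX.elim x⟩
  let := TopologicalSpace.metrizableSpaceMetric E
  let g : ℕ → E → ℝ≥0 := fun n z => ⨅ y, (c y + n * nndist z (j y))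
  have hle : ∀ n z y, g n z ≤ c y + n * nndist z (j y) := fun n z y =>
    ciInf_le (OrderBot.bddBelow _) y
  refine ⟨g, fun n => ?_, fun m n hmn z => ?_, fun x => le_antisymm ?_ ?_⟩
  · refine (LipschitzWith.of_le_add_mul n fun z w => ?_ :
      LipschitzWith n fun z => (g n z : ℝ)).continuous.subtype_mk _
    have key : g n z ≤ g n w + n * nndist z w := by
      rw [← tsub_le_iff_right]
      refine le_ciInf fun y => ?_
      rw [tsub_le_iff_right]
      calc g n z ≤ c y + n * nndist z (j y) := hle n z y
        _ ≤ c y + n * (nndist w (j y) + nndist z w) := by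
          gcongr
          rw [add_comm]
          exact nndist_triangle _ _ _
        _ = _ := by ring
    exact_mod_cast key
  · refine le_ciInf fun y => (hle m z y).trans ?_
    gcongr
  · refine iSup_le fun n => ENNReal.coe_le_coe.2 ?_
    simpa using hle n (j x) x
  · refine ENNReal.le_of_forall_nnreal_lt fun a ha => ?_
    have ha' : a < c x := ENNReal.coe_lt_coe.1 ha
    have hev := hc x a ha'
    rw [hj.nhds_eq_comap] at hev
    obtain ⟨U, hU, hUa⟩ := Filter.mem_comap.1 hev
    obtain ⟨ε, hε, hball⟩ := Metric.mem_nhds_iff.1 hU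
    -- Within distance `ε` the cost alone exceeds `a`; beyond it the penalty is at least `n * ε ≥
    -- a`.
    obtain ⟨n, hn⟩ := exists_nat_ge ((a : ℝ) / ε)
    refine le_iSup_of_le n (ENNReal.coe_le_coe.2 (le_ciInf fun y => ?_))
    by_cases hy : dist (j x) (j y) < ε
    · have : a < c y := hUa (hball (by rwa [Metric.mem_ball, dist_comm]))
      exact this.le.trans le_self_add
    · refine le_add_of_le_right ?_
      rw [← NNReal.coe_le_coe]
      push_cast
      rw [div_le_iff₀ hε] at hn
      exact hn.trans (mul_le_mul_of_nonneg_left (not_lt.1 hy) n.cast_nonneg)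

theorem lowerSemicontinuous_lintegral_iSup {E : Type*} [TopologicalSpace E] [CompactSpace E]
    [MeasurableSpace E] [OpensMeasurableSpace E] {g : ℕ → E → ℝ≥0} (hg : ∀ n, Continuous (g n))
    (hmono : Monotone g) :
    LowerSemicontinuous fun ξ : ProbabilityMeasure E =>
      ∫⁻ z, ⨆ n, (g n z : ℝ≥0∞) ∂(ξ : Measure E) := by
  have h : ∀ ξ : ProbabilityMeasure E, ∫⁻ z, ⨆ n, (g n z : ℝ≥0∞) ∂(ξ : Measure E) =
      ⨆ n, ∫⁻ z, (g n z : ℝ≥0∞) ∂(ξ : Measure E) := fun ξ =>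
    lintegral_iSup (fun n => (hg n).measurable.coe_nnreal_ennreal)
      fun m n hmn z => ENNReal.coe_le_coe.2 (hmono hmn z)
  simp only [h]
  exact lowerSemicontinuous_iSup fun n =>
    (ProbabilityMeasure.continuous_lintegral_continuousMap
      (⟨g n, hg n⟩ : C(E, ℝ≥0))).lowerSemicontinuous

/-! ### Transfer of couplings along the embedding. -/

section Couplings

variable {X K : Type*} [MeasurableSpace X] [MeasurableSpace K] {i : X → K}

theorem map_prodMap_mem_couplings_iff (hi : MeasurableEmbedding i) {μ ν : ProbabilityMeasure X}
    {ξ : ProbabilityMeasure (X × X)} :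
    ξ.map (hi.measurable.prodMap hi.measurable).aemeasurable ∈
      couplings (μ.map hi.measurable.aemeasurable) (ν.map hi.measurable.aemeasurable) ↔
    ξ ∈ couplings μ ν := by
  have h₁ : ((ξ : Measure (X × X)).map (Prod.map i i)).fst = (ξ : Measure (X × X)).fst.map i := by
    rw [Measure.fst, Measure.fst, Measure.map_map measurable_fst
      (hi.measurable.prodMap hi.measurable), Measure.map_map hi.measurable measurable_fst]
    rfl
  have h₂ : ((ξ : Measure (X × X)).map (Prod.map i i)).snd = (ξ : Measure (X × X)).snd.map i := by
    rw [Measure.snd, Measure.snd, Measure.map_map measurable_snd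
      (hi.measurable.prodMap hi.measurable), Measure.map_map hi.measurable measurable_snd]
    rfl
  simp only [couplings, Set.mem_ofPred_eq, ProbabilityMeasure.toMeasure_map, h₁, h₂,
    hi.map_injective.eq_iff]

/-- Both marginals are carried by `Set.range i`, hence `ξ` by the range of `Prod.map i i`, and
`comap` loses no mass. -/
theorem exists_map_prodMap_eq_of_mem_couplings (hi : MeasurableEmbedding i)
    {μ ν : ProbabilityMeasure X} {ξ : ProbabilityMeasure (K × K)}
    (hξ : ξ ∈ couplings (μ.map hi.measurable.aemeasurable) (ν.map hi.measurable.aemeasurable)) :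
    ∃ η : ProbabilityMeasure (X × X), (η : Measure (X × X)) =
        (ξ : Measure (K × K)).comap (Prod.map i i) ∧
      η.map (hi.measurable.prodMap hi.measurable).aemeasurable = ξ := by
  have hj : MeasurableEmbedding (Prod.map i i) := hi.prodMap hi
  have hrange : ∀ᵐ z ∂(ξ : Measure (K × K)), z ∈ Set.range (Prod.map i i) := by
    have aux : ∀ (ρ : ProbabilityMeasure X), ∀ᵐ x ∂((ρ : Measure X).map i), x ∈ Set.range i :=
      fun ρ => (hi.ae_map_iff).2 (Filter.Eventually.of_forall fun x => ⟨x, rfl⟩)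
    have h₁ : ∀ᵐ z ∂(ξ : Measure (K × K)), z.1 ∈ Set.range i := by
      refine ae_of_ae_map measurable_fst.aemeasurable (p := fun x => x ∈ Set.range i) ?_
      have := hξ.1
      rw [Measure.fst, ProbabilityMeasure.toMeasure_map] at this
      rw [this]
      exact aux μ
    have h₂ : ∀ᵐ z ∂(ξ : Measure (K × K)), z.2 ∈ Set.range i := by
      refine ae_of_ae_map measurable_snd.aemeasurable (p := fun x => x ∈ Set.range i) ?_
      have := hξ.2
      rw [Measure.snd, ProbabilityMeasure.toMeasure_map] at this
      rw [this]
      exact aux ν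
    filter_upwards [h₁, h₂] with z hz₁ hz₂
    rw [Set.range_prodMap]
    exact ⟨hz₁, hz₂⟩
  have hmap : ((ξ : Measure (K × K)).comap (Prod.map i i)).map (Prod.map i i) = ξ := by
    rw [hj.map_comap, Measure.restrict_eq_self_of_ae_mem hrange]
  have hprob : IsProbabilityMeasure ((ξ : Measure (K × K)).comap (Prod.map i i)) := by
    constructor
    have h := congrArg (fun m : Measure (K × K) => m Set.univ) hmap
    simpa [hj.map_apply] using h
  exact ⟨⟨_, hprob⟩, rfl, ProbabilityMeasure.toMeasure_injective hmap⟩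

end Couplings

/-- The marginal constraints amount to countably many equations between continuous functionals and
measurable values; the product measure solves them. -/
theorem isMeasurableClosedFamily_couplings {K Ω : Type*} [TopologicalSpace K] [CompactSpace K]
    [T2Space K] [SecondCountableTopology K] [MeasurableSpace K] [BorelSpace K] [MeasurableSpace Ω]
    {μ ν : Ω → ProbabilityMeasure K} (hμ : Measurable fun p => (μ p : Measure K))
    (hν : Measurable fun p => (ν p : Measure K)) :
    IsMeasurableClosedFamily fun p => couplings (μ p) (ν p) := by
  obtain ⟨f, hf⟩ := exists_denseRange_testFunction K
  let H : ℕ ⊕ ℕ → ProbabilityMeasure (K × K) → ℝ≥0∞ :=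
    Sum.elim (fun n ξ => ∫⁻ z, f n z.1 ∂(ξ : Measure (K × K)))
      (fun n ξ => ∫⁻ z, f n z.2 ∂(ξ : Measure (K × K)))
  let t : ℕ ⊕ ℕ → Ω → ℝ≥0∞ :=
    Sum.elim (fun n p => ∫⁻ x, f n x ∂(μ p : Measure K)) (fun n p => ∫⁻ x, f n x ∂(ν p : Measure K))
  have hfm : ∀ n, Measurable fun x => (f n x : ℝ≥0∞) := fun n =>
    (f n).continuous.measurable.coe_nnreal_ennreal
  have hH : ∀ k, Continuous (H k) := by
    rintro (n | n)
    · exact ProbabilityMeasure.continuous_lintegral_continuousMap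
        (⟨fun z => f n z.1, by fun_prop⟩ : C(K × K, ℝ≥0))
    · exact ProbabilityMeasure.continuous_lintegral_continuousMap
        (⟨fun z => f n z.2, by fun_prop⟩ : C(K × K, ℝ≥0))
  have ht : ∀ k, Measurable (t k) := by
    rintro (n | n)
    · exact (Measure.measurable_lintegral (hfm n)).comp hμ
    · exact (Measure.measurable_lintegral (hfm n)).comp hν
  have hiff : ∀ p (ξ : ProbabilityMeasure (K × K)),
      ξ ∈ couplings (μ p) (ν p) ↔ ∀ k, H k ξ = t k p := by
    intro p ξ
    have h₁ : ∀ n, ∫⁻ x, f n x ∂(ξ : Measure (K × K)).fst = H (Sum.inl n) ξ := fun n =>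
      lintegral_map (hfm n) measurable_fst
    have h₂ : ∀ n, ∫⁻ x, f n x ∂(ξ : Measure (K × K)).snd = H (Sum.inr n) ξ := fun n =>
      lintegral_map (hfm n) measurable_snd
    constructor
    · rintro ⟨h, h'⟩ (n | n)
      · rw [← h₁, h]; rfl
      · rw [← h₂, h']; rfl
    · intro h
      exact ⟨measure_eq_of_forall_lintegral_dense_eq hf fun n => (h₁ n).trans (h (Sum.inl n)),
        measure_eq_of_forall_lintegral_dense_eq hf fun n => (h₂ n).trans (h (Sum.inr n))⟩
  convert IsMeasurableClosedFamily.of_continuous_eq H hH t ht fun p => ?_ using 2 with p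
  · ext ξ
    exact hiff p ξ
  · exact ⟨⟨(μ p : Measure K).prod (ν p : Measure K), inferInstance⟩,
      (hiff p _).1 ⟨by simp, by simp⟩⟩

theorem propositionA1
    {X : Type*} [TopologicalSpace X] [PolishSpace X] [MeasurableSpace X] [BorelSpace X]
    {Y : Type*} [MeasurableSpace Y]
    (μ : Y → ProbabilityMeasure X) (hμ : Measurable fun γ => (μ γ : Measure X))
    (c : X × X → ℝ≥0) (hc : LowerSemicontinuous c) :
    (Measurable fun p : Y × Y => transportCost c (μ p.1) (μ p.2)) ∧
    ∃ ξ : Y × Y → ProbabilityMeasure (X × X),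
      (Measurable fun p => (ξ p : Measure (X × X))) ∧
      ∀ p : Y × Y, ξ p ∈ couplings (μ p.1) (μ p.2) ∧
        planCost c (ξ p) = transportCost c (μ p.1) (μ p.2) := by
  obtain ⟨i, hi⟩ : ∃ i : X → ℕ → unitInterval, Topology.IsEmbedding i := by
    let := TopologicalSpace.metrizableSpaceMetric X
    exact Metric.PiNatEmbed.exists_embedding_to_hilbert_cube
  have him : MeasurableEmbedding i := hi.continuous.measurableEmbedding hi.injective
  have hjm : MeasurableEmbedding (Prod.map i i) := him.prodMap him
  obtain ⟨g, hg, hmono, hgc⟩ := exists_monotone_continuous_iSup_comp_eq (hi.prodMap hi) hc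
  let J : ProbabilityMeasure ((ℕ → unitInterval) × (ℕ → unitInterval)) → ℝ≥0∞ := fun ξ =>
    ∫⁻ z, ⨆ n, (g n z : ℝ≥0∞) ∂(ξ : Measure ((ℕ → unitInterval) × (ℕ → unitInterval)))
  have hJ : LowerSemicontinuous J := lowerSemicontinuous_lintegral_iSup hg hmono
  have hJmap : ∀ ξ : ProbabilityMeasure (X × X), J (ξ.map hjm.measurable.aemeasurable) =
      planCost c ξ := by
    intro ξ
    simp only [J, ProbabilityMeasure.toMeasure_map, hjm.lintegral_map, hgc, planCost]
  let μ' : Y → ProbabilityMeasure (ℕ → unitInterval) := fun γ =>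
    (μ γ).map him.measurable.aemeasurable
  have hμ' : Measurable fun γ => (μ' γ : Measure (ℕ → unitInterval)) := by
    simp only [μ', ProbabilityMeasure.toMeasure_map]
    exact (Measure.measurable_map i him.measurable).comp hμ
  have hF := isMeasurableClosedFamily_couplings (μ := fun p : Y × Y => μ' p.1)
    (ν := fun p : Y × Y => μ' p.2) (hμ'.comp measurable_fst) (hμ'.comp measurable_snd)
  have hcost : ∀ p : Y × Y, ⨅ ξ ∈ couplings (μ' p.1) (μ' p.2), J ξ =
      transportCost c (μ p.1) (μ p.2) := by
    intro p
    refine le_antisymm (le_iInf₂ fun ξ hξ => ?_) (le_iInf₂ fun ξ hξ => ?_)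
    · rw [← hJmap]
      exact iInf₂_le _ ((map_prodMap_mem_couplings_iff him).2 hξ)
    · obtain ⟨η, -, rfl⟩ := exists_map_prodMap_eq_of_mem_couplings him hξ
      rw [hJmap]
      exact iInf₂_le η ((map_prodMap_mem_couplings_iff him).1 hξ)
  refine ⟨by simpa only [hcost] using hF.measurable_iInf hJ, ?_⟩
  obtain ⟨f, hf⟩ := exists_denseRange_testFunction ((ℕ → unitInterval) × (ℕ → unitInterval))
  obtain ⟨s, hs, hsm⟩ := (hF.argminFamily hJ).exists_selection
    (fun n ξ => ∫⁻ z, f n z ∂(ξ : Measure ((ℕ → unitInterval) × (ℕ → unitInterval))))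
    fun n => (ProbabilityMeasure.continuous_lintegral_continuousMap (f n)).lowerSemicontinuous
  choose ξ hξ hξs using fun p => exists_map_prodMap_eq_of_mem_couplings him (hs p).1
  have hmeas := measurable_of_forall_measurable_lintegral_dense hf _ hsm
  refine ⟨ξ, Measure.measurable_of_measurable_coe _ fun B hB => ?_, fun p => ⟨?_, ?_⟩⟩
  -- The mass of `B` under `ξ p` is that of its image under `s p`, and the image is Borel.
  · simp only [hξ, hjm.comap_apply]
    exact (Measure.measurable_coe (hjm.measurableSet_image.2 hB)).comp hmeas
  · rw [← map_prodMap_mem_couplings_iff him, hξs]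
    exact (hs p).1
  · rw [← hJmap, hξs, ← hcost]
    exact eq_iInf_of_mem_argminFamily (hs p)
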